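/- **Setting.** A *measurement scenario* is a set $X$ of measurements with a family $\mathcal C$ of finite subsets (contexts) that covers $X$, contains $\emptyset$, and is closed under intersections and under $V\setminus U$ for $U\subseteq V$ in $\mathcal C$. Its *minimal contexts* are the minimal nonempty elements of $\mathcal C$. Each $m\in X$ has a measurable outcome space $O^m$, and $O^W=\prod_{m\in W}O^m$ with the product $\sigma$-algebra for $W\subseteq X$. For a semiring $R$ with a Hausdorff topology (for instance the discrete one), an *$R$-measure* is a $\sigma$-additive $R$-valued set function of total mass $1_R$; for $V\subseteq W$, $\nu|_V$ is the marginal on $O^V$ of an $R$-measure $\nu$ on $O^W$. An *$R$-measure fibration* assigns to every $U\in\mathcal C$ an $R$-measure $\mu^U$ on $O^U$; its total space consists of the points $(U,O^U,\mu^U)$, projected to $U$. It is an *$R$-measure $G$-fibration*, $G$ a topological monoid, if moreover $X$ and the total space $\bigsqcup_{m}O^m$ carry topologies for which the projection $\bigsqcup_m O^m\to X$ is continuous, the fibers $O^m$ are pairwise weak-homotopy equivalent (their homotopy groups are isomorphic), and $G$ acts continuously on $\bigsqcup_m O^m$ by measurable maps that preserve each fiber. **Triviality.** The fibration is *trivial*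 if the independence condition between fibers holds globally: there is an $R$-measure $\nu$ on $O^X$ such that every fiber $(O^U,\mu^U)$, $U\in\mathcal C$, is the restriction of $(O^X,\nu)$ to the first factor of $O^X=O^U\times O^{X\setminus U}$. **Non-contextuality.** A *section* over $W\subseteq X$ is given by an $R$-measure $\nu$ on $O^W$ such that $V\mapsto (V,O^V,\nu|_V)$, for contexts $V\subseteq W$, takes values in the total space, i.e. $\nu|_V=\mu^V$. The fibration is *$R$-non-contextual* * *by section* if every section over a context extends to a section over $X$ (that is, for every $U\in\mathcal C$ and every section $\nu$ over $U$ there is a section $\nu'$ over $X$ with $\nu'|_U=\nu$); * *by marginals* if there is an $R$-measure $\nu$ on $O^X$ with $\mu^U=\nu|_U$ for all $U\in\mathcal C$; * *by model*, for $R=\mathbb R_{\ge 0}$, if there are a probability space $(\Lambda,p)$ and, for each minimal context $V$, a Markov kernel $\lambda\mapsto\mu^{(V,\lambda)}$ from $\Lambda$ to $O^V$, such that for all $U\in\mathcal C$ one has $\mu^U=\int_\Lambda\prod_{V\subseteq U\text{ minimal}}\mu^{(V,\lambda)}\,dp(\lambda)$, where the two sides are compared on product events $\prod_V\sigma_V$;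 * *by finite model*, for a commutative semiring $R$, if there are a finite set $\Lambda$, weights $p:\Lambda\to R$ with $\sum_\lambda p(\lambda)=1_R$, and $R$-measures $\mu^{(V,\lambda)}$ on $O^V$ such that for all $U\in\mathcal C$ one has $\mu^U=\sum_{\lambda}p(\lambda)\prod_{V\subseteq U\text{ minimal}}\mu^{(V,\lambda)}$ on product events. **Corollary.** An $R$-measure $G$-fibration is $R$-non-contextual if and only if it is trivial. Precisely: 1. for every semiring $R$ with a Hausdorff topology and arbitrary measurable outcome spaces, an $R$-measure $G$-fibration is non-contextual by section if and only if it is trivial, and non-contextual by marginals if and only if it is trivial; 2. for $R=\mathbb R_{\ge0}$ and arbitrary measurable outcome spaces, it is non-contextual by model if and only if it is trivial; 3. for every commutative semiring $R$ with a Hausdorff topology, if $X$ and all $O^m$ are finite and all points of the $O^m$ are measurable, it is non-contextual by finite model if and only if it is trivial. -/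

import Mathlib

open MeasureTheory ProbabilityTheory
open scoped NNReal ENNReal

universe u v w

/-! ### Measurement scenarios -/

/-- A measurement scenario: a set `X` of measurements covered by a family of finite contexts
which contains the empty set and is closed under intersections and relative complements. -/
structure MeasurementScenario (X : Type u) where
  contexts : Set (Set X)
  finite_context : ∀ U ∈ contexts, U.Finite
  covers : ⋃₀ contexts = Set.univ
  empty_mem : ∅ ∈ contexts
  inter_mem : ∀ U ∈ contexts, ∀ V ∈ contexts, U ∩ V ∈ contexts
  diff_mem : ∀ U ∈ contexts, ∀ V ∈ contexts, U ⊆ V → V \ U ∈ contexts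

namespace MeasurementScenario

variable {X : Type u} (S : MeasurementScenario X)

/-- Minimal contexts: the minimal elements among the nonempty contexts. -/
def IsMinimalContext (V : Set X) : Prop :=
  V ∈ S.contexts ∧ V.Nonempty ∧ ∀ W ∈ S.contexts, W ⊆ V → W.Nonempty → W = V

/-- The type of minimal contexts. -/
abbrev MinimalContext : Type u := {V : Set X // S.IsMinimalContext V}

/-- The minimal contexts contained in `U`. -/
abbrev MinimalContextIn (U : Set X) : Type u := {V : S.MinimalContext // V.1 ⊆ U}

/-- A context has finitely many minimal parts, so that products over them are genuine. -/
theorem finite_minimalContextIn {U : Set X} (hU : U ∈ S.contexts) :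
    Finite (S.MinimalContextIn U) := by
  have h : Finite (𝒫 U) := (S.finite_context U hU).finite_subsets.to_subtype
  exact Finite.of_injective
    (fun V : S.MinimalContextIn U => (⟨V.1.1, V.2⟩ : 𝒫 U))
    (fun V W hVW => Subtype.ext (Subtype.ext (by injection hVW)))

end MeasurementScenario

/-! ### Outcomes -/

/-- The outcomes `O^W = ∏_{m ∈ W} O^m` of a set `W` of measurements, with the product
`σ`-algebra (local independent gluing). -/
abbrev Fiber {X : Type u} (O : X → Type v) (W : Set X) : Type (max u v) := ∀ m : W, O m

/-- The Cartesian decomposition `O^W = O^V × O^{W ∖ V}` for `V ⊆ W`. -/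
def Fiber.split {X : Type u} {O : X → Type v} {V W : Set X} (h : V ⊆ W) (x : Fiber O W) :
    Fiber O V × Fiber O (W \ V) :=
  (fun m => x ⟨m.1, h m.2⟩, fun m => x ⟨m.1, m.2.1⟩)

/-! ### Measures with values in a semiring -/

/-- A normalised `R`-measure: a `σ`-additive `R`-valued set function of total mass `1`. -/
structure RMeasure (R : Type w) [Semiring R] [TopologicalSpace R]
    (α : Type*) [MeasurableSpace α] where
  toVectorMeasure : VectorMeasure α R
  total : toVectorMeasure Set.univ = 1

namespace RMeasure

variable {R : Type w} [Semiring R] [TopologicalSpace R]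

/-- The image of a normalised `R`-measure under a measurable map. -/
noncomputable def map {α β : Type*} [MeasurableSpace α] [MeasurableSpace β] (μ : RMeasure R α)
    (f : α → β) (hf : Measurable f) : RMeasure R β where
  toVectorMeasure := μ.toVectorMeasure.map f
  total := by
    rw [VectorMeasure.map_apply _ hf MeasurableSet.univ, Set.preimage_univ, μ.total]

/-- The marginal on `O^V` of an `R`-measure on `O^W`, for `V ⊆ W`. -/
noncomputable def marginal {X : Type u} {O : X → Type v} [∀ m, MeasurableSpace (O m)]
    {V W : Set X} (μ : RMeasure R (Fiber O W)) (h : V ⊆ W) : RMeasure R (Fiber O V) :=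
  μ.map (Set.domRestrict₂ (π := O) h) (Set.measurable_restrict₂ h)

/-- The independent gluing condition for fibers with `R`-measure: with respect to the
decomposition `O^W = O^V × O^{W ∖ V}`, the fiber `(O^V, μ)` is the restriction of
`(O^W, ν)` to its first factor. -/
def IsIndependentGluing {X : Type u} {O : X → Type v} [∀ m, MeasurableSpace (O m)]
    {V W : Set X} (ν : RMeasure R (Fiber O W)) (μ : RMeasure R (Fiber O V)) (h : V ⊆ W) : Prop :=
  ∀ A : Set (Fiber O V), MeasurableSet A →
    μ.toVectorMeasure A =
      ν.toVectorMeasure (Fiber.split h ⁻¹' (A ×ˢ (Set.univ : Set (Fiber O (W \ V)))))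

end RMeasure

/-! ### `R`-measure fibrations (empirical models) -/

/-- An `R`-measure fibration over the scenario `S` with outcome spaces `O^m`: an `R`-state, which
assigns to every context `U` a normalised `R`-measure on `O^U`.
No compatibility between different contexts is required. -/
structure RMeasureFibration (R : Type w) [Semiring R] [TopologicalSpace R]
    {X : Type u} (S : MeasurementScenario X) (O : X → Type v) [∀ m, MeasurableSpace (O m)] where
  state : ∀ U ∈ S.contexts, RMeasure R (Fiber O U)

namespace RMeasureFibration

variable {R : Type w} [Semiring R] [TopologicalSpace R] {X : Type u}
  {S : MeasurementScenario X} {O : X → Type v} [∀ m, MeasurableSpace (O m)]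

/-- The total space, whose points are `(U, O^U, μ^U)` with `U` a context. -/
def Total (M : RMeasureFibration R S O) : Type (max u v w) :=
  Σ U : S.contexts, {μ : RMeasure R (Fiber O U.1) // μ = M.state U.1 U.2}

/-- The projection of the total space onto the contexts. -/
def proj (M : RMeasureFibration R S O) (e : M.Total) : S.contexts := e.1

/-- A section over a set `W` of measurements is given by an `R`-measure `ν` on `O^W` such that
`V ↦ (V, O^V, ν|_V)`, for `V ⊆ W` a context, takes its values in the total space. -/
structure MeasureSection (M : RMeasureFibration R S O) (W : Set X) where
  measure : RMeasure R (Fiber O W)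
  mem_total : ∀ V (hV : V ∈ S.contexts) (h : V ⊆ W), measure.marginal h = M.state V hV

/-- The map from the contexts in `W` to the total space given by a section over `W`. -/
noncomputable def MeasureSection.toFun {M : RMeasureFibration R S O} {W : Set X}
    (s : M.MeasureSection W) (V : {V : S.contexts // V.1 ⊆ W}) : M.Total :=
  ⟨V.1, s.measure.marginal V.2, s.mem_total V.1.1 V.1.2 V.2⟩

theorem MeasureSection.proj_toFun {M : RMeasureFibration R S O} {W : Set X}
    (s : M.MeasureSection W) (V : {V : S.contexts // V.1 ⊆ W}) : M.proj (s.toFun V) = V.1 := rfl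

/-- `R`-non-contextuality by section: every local section, i.e. section over a context, extends
to a global section. -/
def NonContextualBySection (M : RMeasureFibration R S O) : Prop :=
  ∀ U ∈ S.contexts, ∀ s : M.MeasureSection U, ∃ t : M.MeasureSection Set.univ,
    t.measure.marginal (Set.subset_univ U) = s.measure

/-- `R`-non-contextuality by marginals: there is a normalised `R`-measure on `O^X` whose
marginals are the given `R`-measures of the contexts. -/
def NonContextualByMarginals (M : RMeasureFibration R S O) : Prop :=
  ∃ ν : RMeasure R (Fiber O Set.univ), ∀ U (hU : U ∈ S.contexts),
    M.state U hU = ν.marginal (Set.subset_univ U)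

/-- Triviality: the independence condition between fibers holds globally, i.e. there is a fiber
`(O^X, ν)` over the whole of `X` with which the fibers `(O^U, μ^U)` over all contexts satisfy
the independent gluing condition. -/
def IsTrivial (M : RMeasureFibration R S O) : Prop :=
  ∃ ν : RMeasure R (Fiber O Set.univ), ∀ U (hU : U ∈ S.contexts),
    ν.IsIndependentGluing (M.state U hU) (Set.subset_univ U)

end RMeasureFibration

/-! ### Hidden variables -/

/-- The product event `∏ σ_V` in `O^U`, over the minimal contexts `V ⊆ U`. -/
def productEvent {X : Type u} (S : MeasurementScenario X) {O : X → Type v} (U : Set X)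
    (σ : ∀ V : S.MinimalContext, Set (Fiber O V.1)) : Set (Fiber O U) :=
  {x | ∀ V : S.MinimalContextIn U, Set.domRestrict₂ (π := O) V.2 x ∈ σ V.1}

namespace RMeasureFibration

variable {X : Type u} {S : MeasurementScenario X} {O : X → Type v} [∀ m, MeasurableSpace (O m)]

/-- `ℝ≥0`-non-contextuality by model: `μ^U = ∫ ∏_{V ⊆ U minimal} μ^{(V, l)} dp(l)` for a
probability measure `p` on a measurable space of hidden variables `l` and probability measures
`μ^{(V, l)}` on `O^V` which depend measurably on `l`. The measure on the right is described by
its values on product events. -/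
def NonContextualByModel (M : RMeasureFibration ℝ≥0 S O) : Prop :=
  ∃ (L : Type (max u v)) (_ : MeasurableSpace L) (p : Measure L) (_ : IsProbabilityMeasure p)
    (K : ∀ V : S.MinimalContext, Kernel L (Fiber O V.1)) (_ : ∀ V, IsMarkovKernel (K V)),
    ∀ U (hU : U ∈ S.contexts) (σ : ∀ V : S.MinimalContext, Set (Fiber O V.1)),
      (∀ V, MeasurableSet (σ V)) →
        (((M.state U hU).toVectorMeasure (productEvent S U σ) : ℝ≥0) : ℝ≥0∞) =
          ∫⁻ l, ∏ᶠ V : S.MinimalContextIn U, K V.1 l (σ V.1) ∂p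

/-- `R`-non-contextuality by a finite model, for an arbitrary commutative semiring `R`:
`μ^U = ∑_l p(l) ∏_{V ⊆ U minimal} μ^{(V, l)}` with finitely many hidden variables `l`, weights
`p(l)` in `R` with sum `1` and normalised `R`-measures `μ^{(V, l)}` on `O^V`. -/
def NonContextualByFiniteModel {R : Type w} [CommSemiring R] [TopologicalSpace R]
    (M : RMeasureFibration R S O) : Prop :=
  ∃ (L : Type (max u v)) (_ : Fintype L) (p : L → R) (_ : ∑ l, p l = 1)
    (K : ∀ V : S.MinimalContext, L → RMeasure R (Fiber O V.1)),
    ∀ U (hU : U ∈ S.contexts) (σ : ∀ V : S.MinimalContext, Set (Fiber O V.1)),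
      (∀ V, MeasurableSet (σ V)) →
        (M.state U hU).toVectorMeasure (productEvent S U σ) =
          ∑ l, p l * ∏ᶠ V : S.MinimalContextIn U, (K V.1 l).toVectorMeasure (σ V.1)

end RMeasureFibration

/-! ### `G`-fibrations -/

/-- Two spaces are weak-homotopy equivalent if their homotopy groups are isomorphic: there is a
bijection of the sets of path components, such that all higher homotopy groups at points of
corresponding components are isomorphic. -/
def WeakHomotopyEquivalent (A : Type*) (B : Type*) [TopologicalSpace A] [TopologicalSpace B] :
    Prop :=
  ∃ e : ZerothHomotopy A ≃ ZerothHomotopy B, ∀ (a : A) (b : B),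
    e (Quotient.mk (pathSetoid A) a) = Quotient.mk (pathSetoid B) b →
      ∀ n : ℕ, Nonempty (HomotopyGroup.Pi (n + 1) A a ≃* HomotopyGroup.Pi (n + 1) B b)

/-- A `G`-fibration structure with fibers `O^m` over `X`: topologies on the base and on the total
space such that the projection is continuous, the fibers are weak-homotopy equivalent to each
other, and the topological monoid `G` acts continuously on the total space by measurable
transformations of the fibers. -/
structure GFibration (G : Type*) [Monoid G] [TopologicalSpace G] {X : Type u}
    (O : X → Type v) [∀ m, MeasurableSpace (O m)] where
  [baseTopology : TopologicalSpace X]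
  [totalTopology : TopologicalSpace (Σ m, O m)]
  continuous_proj : Continuous (Sigma.fst : (Σ m, O m) → X)
  weakHomotopyEquivalent : ∀ m n : X,
    WeakHomotopyEquivalent {e : Σ m, O m // e.1 = m} {e : Σ m, O m // e.1 = n}
  [action : MulAction G (Σ m, O m)]
  continuous_action : Continuous (fun q : G × (Σ m, O m) => q.1 • q.2)
  measurable_action : ∀ g : G, Measurable (fun e : Σ m, O m => g • e)
  action_fiber : ∀ (g : G) (e : Σ m, O m), (g • e).1 = e.1

/-- An `R`-measure `G`-fibration: an `R`-measure fibration whose outcome spaces form a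
`G`-fibration over the set of measurements. -/
structure RMeasureGFibration (G : Type*) [Monoid G] [TopologicalSpace G]
    (R : Type w) [Semiring R] [TopologicalSpace R]
    {X : Type u} (S : MeasurementScenario X) (O : X → Type v) [∀ m, MeasurableSpace (O m)]
    extends RMeasureFibration R S O, GFibration G O

/-! ### Minimal contexts partition the measurements -/

namespace MeasurementScenario

variable {X : Type u} (S : MeasurementScenario X)

/-! The preimage of `A × O^{X∖U}` under the splitting is the preimage of `A` under restriction, so
triviality is the marginal condition. The state over `∅` is always a section, and a global extension
of it has all prescribed marginals; conversely a section over a context `U` is forced to be `μ^U`,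
which any global `ν` with the right marginals extends. Given `ν`, a model takes the global outcomes
themselves as hidden variables, distributed by `ν`, with deterministic responses. Given a model,
minimal contexts partition `X`, so `O^X = ∏_V O^V` (`glue`), and averaging the product measures of
the kernels gives `ν`. Its marginals agree with the states on product events. Over `ℝ≥0` these are a
generating π-system; over a general semiring there is no subtraction for that argument, but in the
finite case points are product events and determine everything. -/

theorem exists_minimalContext_mem (m : X) : ∃ V : S.MinimalContext, m ∈ V.1 := by
  obtain ⟨U, hU, hmU⟩ : m ∈ ⋃₀ S.contexts := S.covers ▸ Set.mem_univ m
  have hfin : {W | W ∈ S.contexts ∧ W ⊆ U ∧ m ∈ W}.Finite :=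
    (S.finite_context U hU).finite_subsets.subset fun W hW => hW.2.1
  obtain ⟨W, ⟨hW, hWU, hmW⟩, hmin⟩ :=
    hfin.exists_minimal ⟨U, hU, subset_rfl, hmU⟩
  refine ⟨⟨W, hW, ⟨m, hmW⟩, fun V hV hVW hne => ?_⟩, hmW⟩
  -- `W` is minimal only among contexts containing `m`. If `V` misses `m`, then `W \ V` is a context
  -- containing `m`, so minimality forces `V` to be empty.
  by_cases hmV : m ∈ V
  · exact hVW.antisymm (hmin ⟨hV, hVW.trans hWU, hmV⟩ hVW)
  · obtain ⟨x, hx⟩ := hne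
    have h := hmin ⟨S.diff_mem V hV W hW hVW, Set.sdiff_subset.trans hWU, hmW, hmV⟩
      Set.sdiff_subset
    exact absurd hx (h (hVW hx)).2

variable {S}

theorem MinimalContext.subset_of_mem {V : S.MinimalContext} {U : Set X} (hU : U ∈ S.contexts)
    {m : X} (hV : m ∈ V.1) (hm : m ∈ U) : V.1 ⊆ U := by
  have h := V.2.2.2 _ (S.inter_mem _ V.2.1 _ hU) Set.inter_subset_left ⟨m, hV, hm⟩
  exact Set.inter_eq_left.1 h

theorem MinimalContext.eq_of_mem {V W : S.MinimalContext} {m : X} (hV : m ∈ V.1)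
    (hW : m ∈ W.1) : V = W :=
  Subtype.ext ((subset_of_mem W.2.1 hV hW).antisymm (subset_of_mem V.2.1 hW hV))

variable (S)

/-- The minimal context that contains a given measurement. -/
noncomputable def minimalContextAt (m : X) : S.MinimalContext :=
  (S.exists_minimalContext_mem m).choose

theorem mem_minimalContextAt (m : X) : m ∈ (S.minimalContextAt m).1 :=
  (S.exists_minimalContext_mem m).choose_spec

theorem minimalContextAt_eq {V : S.MinimalContext} {m : X} (hm : m ∈ V.1) :
    S.minimalContextAt m = V :=
  MinimalContext.eq_of_mem (S.mem_minimalContextAt m) hm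

/-- Outcomes of all minimal contexts glue uniquely to an outcome of all measurements. -/
noncomputable def glue (O : X → Type v) :
    (∀ V : S.MinimalContext, Fiber O V.1) ≃ Fiber O Set.univ where
  toFun x := fun m => x (S.minimalContextAt m) ⟨m, S.mem_minimalContextAt m⟩
  invFun y := fun V => Set.domRestrict₂ (π := O) (Set.subset_univ V.1) y
  left_inv x := by
    funext V m
    obtain ⟨m, hm⟩ := m
    -- Substituting for `V` avoids transporting outcomes along an equality of contexts.
    obtain rfl := S.minimalContextAt_eq hm
    rfl
  right_inv y := rfl

theorem domRestrict₂_glue (O : X → Type v) (x : ∀ V : S.MinimalContext, Fiber O V.1)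
    (V : S.MinimalContext) :
    Set.domRestrict₂ (π := O) (Set.subset_univ V.1) (S.glue O x) = x V :=
  congrFun ((S.glue O).left_inv x) V

theorem measurable_glue (O : X → Type v) [∀ m, MeasurableSpace (O m)] :
    Measurable (S.glue O) := by
  refine measurable_pi_lambda _ fun m => ?_
  exact (measurable_pi_apply (⟨m, S.mem_minimalContextAt m⟩ : (S.minimalContextAt m.1).1)).comp
    (measurable_pi_apply (S.minimalContextAt m.1))

theorem glue_preimage_productEvent {O : X → Type v} (U : Set X)
    (σ : ∀ V : S.MinimalContext, Set (Fiber O V.1)) :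
    S.glue O ⁻¹' (Set.domRestrict₂ (π := O) (Set.subset_univ U) ⁻¹' productEvent S U σ) =
      Set.pi {V | V.1 ⊆ U} σ := by
  ext x
  simp only [Set.mem_preimage, productEvent, Set.mem_ofPred_eq, Set.mem_pi, Subtype.forall (p := fun V : S.MinimalContext => V.1 ⊆ U)]
  refine forall₂_congr fun V hV => ?_
  rw [← S.domRestrict₂_glue O x V]
  rfl

end MeasurementScenario

/-! ### Product events -/

section ProductEvent

variable {X : Type u} (S : MeasurementScenario X) {O : X → Type v}

theorem productEvent_inter (U : Set X) (σ τ : ∀ V : S.MinimalContext, Set (Fiber O V.1)) :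
    productEvent S U σ ∩ productEvent S U τ = productEvent S U (fun V => σ V ∩ τ V) := by
  ext x
  simp only [productEvent, Set.mem_inter_iff, Set.mem_ofPred_eq, forall_and]

/-- The minimal contexts inside `U` cover `U`, so together they fix every coordinate. The guard `m ∈
U` is there because the event must also be given for `V` not inside `U`. -/
theorem productEvent_singleton {U : Set X} (hU : U ∈ S.contexts) (y : Fiber O U) :
    productEvent S U (fun V => {z | ∀ m (h : m ∈ V.1) (h' : m ∈ U), z ⟨m, h⟩ = y ⟨m, h'⟩}) =
      {y} := by
  ext x
  simp only [productEvent, Set.mem_ofPred_eq, Set.mem_singleton_iff]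
  refine ⟨fun h => funext fun m => ?_, ?_⟩
  · have hm := S.mem_minimalContextAt m.1
    exact h ⟨_, MeasurementScenario.MinimalContext.subset_of_mem hU hm m.2⟩ m.1 hm m.2
  · rintro rfl V m h h'
    rfl

variable [∀ m, MeasurableSpace (O m)]

theorem measurableSet_productEvent {U : Set X} (hU : U ∈ S.contexts)
    {σ : ∀ V : S.MinimalContext, Set (Fiber O V.1)} (hσ : ∀ V, MeasurableSet (σ V)) :
    MeasurableSet (productEvent S U σ) := by
  have := S.finite_minimalContextIn hU
  have h : productEvent S U σ =
      ⋂ V : S.MinimalContextIn U, Set.domRestrict₂ (π := O) V.2 ⁻¹' σ V.1 := by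
    ext x
    simp [productEvent]
  rw [h]
  exact MeasurableSet.iInter fun V => Set.measurable_restrict₂ V.2 (hσ V.1)

/-- The measurable product events in `O^U`. -/
def productEvents (O : X → Type v) [∀ m, MeasurableSpace (O m)] (U : Set X) :
    Set (Set (Fiber O U)) :=
  {A | ∃ σ : ∀ V : S.MinimalContext, Set (Fiber O V.1),
    (∀ V, MeasurableSet (σ V)) ∧ productEvent S U σ = A}

theorem isPiSystem_productEvents (U : Set X) : IsPiSystem (productEvents S O U) := by
  rintro _ ⟨σ, hσ, rfl⟩ _ ⟨τ, hτ, rfl⟩ _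
  exact ⟨_, fun V => (hσ V).inter (hτ V), (productEvent_inter S U σ τ).symm⟩

/-- A one-coordinate cylinder at `m` is a product event constraining only the minimal context
through `m`. -/
theorem generateFrom_productEvents {U : Set X} (hU : U ∈ S.contexts) :
    (inferInstance : MeasurableSpace (Fiber O U)) =
      MeasurableSpace.generateFrom (productEvents S O U) := by
  classical
  refine le_antisymm ?_ (MeasurableSpace.generateFrom_le ?_)
  · refine iSup_le fun m => ?_
    rintro _ ⟨A, hA, rfl⟩
    refine MeasurableSpace.measurableSet_generateFrom
      ⟨fun V => {x | ∀ h : m.1 ∈ V.1, x ⟨m.1, h⟩ ∈ A}, fun V => ?_, ?_⟩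
    · by_cases h : m.1 ∈ V.1
      · have h' := measurable_pi_apply (X := fun m : V.1 => O m) ⟨m.1, h⟩ hA
        simp only [h, forall_true_left]
        exact h'
      · convert MeasurableSet.univ
        exact Set.eq_univ_of_forall fun x h' => absurd h' h
    · ext x
      simp only [productEvent, Set.mem_ofPred_eq, Set.mem_preimage]
      have hm := S.mem_minimalContextAt m.1
      exact ⟨fun h => h ⟨_, MeasurementScenario.MinimalContext.subset_of_mem hU hm m.2⟩ hm,
        fun h _ _ => h⟩
  · rintro _ ⟨σ, hσ, rfl⟩
    exact measurableSet_productEvent S hU hσ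

end ProductEvent

/-! ### Measures with values in a semiring -/

namespace RMeasure

section General

variable {R : Type w} [Semiring R] [TopologicalSpace R] {α : Type*} [MeasurableSpace α]

theorem ext_of_measurableSet {μ ν : RMeasure R α}
    (h : ∀ A, MeasurableSet A → μ.toVectorMeasure A = ν.toVectorMeasure A) : μ = ν := by
  have := VectorMeasure.ext h
  cases μ
  cases ν
  cases this
  rfl

theorem marginal_apply {X : Type u} {O : X → Type v} [∀ m, MeasurableSpace (O m)]
    {V W : Set X} (μ : RMeasure R (Fiber O W)) (h : V ⊆ W) {A : Set (Fiber O V)}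
    (hA : MeasurableSet A) :
    (μ.marginal h).toVectorMeasure A =
      μ.toVectorMeasure (Set.domRestrict₂ (π := O) h ⁻¹' A) :=
  VectorMeasure.map_apply _ (Set.measurable_restrict₂ h) hA

theorem marginal_self {X : Type u} {O : X → Type v} [∀ m, MeasurableSpace (O m)]
    {W : Set X} (μ : RMeasure R (Fiber O W)) : μ.marginal subset_rfl = μ :=
  ext_of_measurableSet fun _ hA => marginal_apply _ _ hA

theorem isIndependentGluing_iff {X : Type u} {O : X → Type v} [∀ m, MeasurableSpace (O m)]
    {V W : Set X} (ν : RMeasure R (Fiber O W)) (μ : RMeasure R (Fiber O V)) (h : V ⊆ W) :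
    ν.IsIndependentGluing μ h ↔ μ = ν.marginal h := by
  have hpre : ∀ A : Set (Fiber O V),
      Fiber.split h ⁻¹' (A ×ˢ (Set.univ : Set (Fiber O (W \ V)))) =
        Set.domRestrict₂ (π := O) h ⁻¹' A := by
    intro A
    ext x
    simp only [Set.mem_preimage, Set.mem_prod, Set.mem_univ, and_true]
    rfl
  refine ⟨fun H => ext_of_measurableSet fun A hA => ?_, ?_⟩
  · rw [H A hA, hpre, marginal_apply _ _ hA]
  · rintro rfl A hA
    rw [hpre, marginal_apply _ _ hA]

/-- The normalised `R`-measure concentrated at a point. -/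
noncomputable def dirac (R : Type w) [Semiring R] [TopologicalSpace R] (x : α) :
    RMeasure R α where
  toVectorMeasure := VectorMeasure.dirac x 1
  total := VectorMeasure.dirac_apply_of_mem MeasurableSet.univ (Set.mem_univ x)

open Classical in
theorem dirac_apply (x : α) {A : Set α} (hA : MeasurableSet A) :
    (dirac R x).toVectorMeasure A = if x ∈ A then 1 else 0 := by
  split_ifs with h
  · exact VectorMeasure.dirac_apply_of_mem hA h
  · exact VectorMeasure.dirac_apply_of_notMem h

end General

section Finite

variable {R : Type w} [Semiring R] [TopologicalSpace R] {α : Type*} [Fintype α]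

open Classical in
theorem hasSum_weights (w : α → R) {f : ℕ → Set α} (hf : Pairwise (Function.onFun Disjoint f)) :
    HasSum (fun i => ∑ x with x ∈ f i, w x) (∑ x with x ∈ ⋃ i, f i, w x) := by
  -- Disjoint nonempty sets have distinct chosen points, so only finitely many are nonempty and the
  -- series is a finite sum.
  have hinj : Function.Injective fun i : {i | (f i).Nonempty} => i.2.some := by
    intro i j hij
    by_contra hne
    refine Set.disjoint_left.1 (hf fun h => hne (Subtype.ext h)) i.2.some_mem ?_
    change i.2.some = j.2.some at hij
    rw [hij]
    exact j.2.some_mem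
  have hfin : {i | (f i).Nonempty}.Finite :=
    Set.finite_coe_iff.1 (Finite.of_injective _ hinj)
  have hU : (∑ x with x ∈ ⋃ i, f i, w x) = ∑ i ∈ hfin.toFinset, ∑ x with x ∈ f i, w x := by
    rw [← Finset.sum_biUnion]
    · congr 1
      ext x
      simp only [Finset.mem_filter, Finset.mem_univ, true_and, Set.mem_iUnion,
        Finset.mem_biUnion, Set.Finite.mem_toFinset, Set.mem_ofPred_eq]
      exact ⟨fun ⟨i, hi⟩ => ⟨i, ⟨x, hi⟩, hi⟩, fun ⟨i, _, hi⟩ => ⟨i, hi⟩⟩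
    · intro i _ j _ hij
      rw [Function.onFun, Finset.disjoint_left]
      intro x hx hx'
      exact Set.disjoint_left.1 (hf hij) (Finset.mem_filter.1 hx).2 (Finset.mem_filter.1 hx').2
  rw [hU]
  refine hasSum_sum_of_ne_finset_zero fun i hi => Finset.sum_eq_zero fun x hx => ?_
  have hne : (f i).Nonempty := ⟨x, (Finset.mem_filter.1 hx).2⟩
  exact absurd (hfin.mem_toFinset.2 hne) hi

variable [MeasurableSpace α] [DiscreteMeasurableSpace α]

open Classical in
theorem apply_eq_sum [T2Space R] (μ : RMeasure R α) (A : Set α) :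
    μ.toVectorMeasure A = ∑ x with x ∈ A, μ.toVectorMeasure {x} := by
  rw [← VectorMeasure.of_biUnion_finset]
  · congr 1
    ext x
    simp
  · intro x _ y _ hxy
    simpa using hxy
  · exact fun x _ => MeasurableSet.of_discrete

theorem sum_singleton [T2Space R] (μ : RMeasure R α) :
    ∑ x, μ.toVectorMeasure {x} = 1 := by
  classical
  rw [← μ.total, apply_eq_sum μ Set.univ]
  simp

theorem ext_of_singleton [T2Space R] {μ ν : RMeasure R α}
    (h : ∀ x, μ.toVectorMeasure {x} = ν.toVectorMeasure {x}) : μ = ν :=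
  ext_of_measurableSet fun A _ => by simp only [apply_eq_sum _ A, h]

open Classical in
/-- The normalised `R`-measure on a finite discrete space with given weights of the points. -/
noncomputable def ofWeights (w : α → R) (hw : ∑ x, w x = 1) : RMeasure R α where
  toVectorMeasure :=
    { measureOf' := fun A => ∑ x with x ∈ A, w x
      empty' := by simp
      not_measurable' := fun A hA => absurd MeasurableSet.of_discrete hA
      m_iUnion' := fun f _ hf => hasSum_weights w hf }
  total := by
    refine Eq.trans (Finset.sum_congr ?_ fun _ _ => rfl) hw
    ext x
    simp

open Classical in
theorem ofWeights_apply (w : α → R) (hw : ∑ x, w x = 1) (A : Set α) :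
    (ofWeights w hw).toVectorMeasure A = ∑ x with x ∈ A, w x := rfl

end Finite

/-! ### Normalised `ℝ≥0`-measures as probability measures. -/

section NNReal

variable {α : Type*} [MeasurableSpace α]

/-- A probability measure as a normalised `ℝ≥0`-measure. -/
noncomputable def ofMeasure (μ : Measure α) [IsProbabilityMeasure μ] : RMeasure ℝ≥0 α where
  toVectorMeasure :=
    { measureOf' := fun A => (μ.toENNRealVectorMeasure A).toNNReal
      empty' := by simp
      not_measurable' := fun A hA => by rw [VectorMeasure.not_measurable _ hA]; rfl
      m_iUnion' := fun f hf hd => by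
        have h := VectorMeasure.m_iUnion μ.toENNRealVectorMeasure hf hd
        have hne : ∀ A, μ.toENNRealVectorMeasure A ≠ ∞ := fun A => by
          rw [Measure.toENNRealVectorMeasure_apply]
          split_ifs <;> simp
        rw [← ENNReal.hasSum_coe]
        simpa only [ENNReal.coe_toNNReal (hne _)] using h }
  total := by
    change (μ.toENNRealVectorMeasure Set.univ).toNNReal = 1
    simp [Measure.toENNRealVectorMeasure_apply]

theorem coe_ofMeasure_apply (μ : Measure α) [IsProbabilityMeasure μ] {A : Set α}
    (hA : MeasurableSet A) : ((ofMeasure μ).toVectorMeasure A : ℝ≥0∞) = μ A := by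
  change ((μ.toENNRealVectorMeasure A).toNNReal : ℝ≥0∞) = μ A
  rw [Measure.toENNRealVectorMeasure_apply_measurable hA, ENNReal.coe_toNNReal (by simp)]

/-- A normalised `ℝ≥0`-measure as a measure. -/
noncomputable def toMeasure (μ : RMeasure ℝ≥0 α) : Measure α :=
  (μ.toVectorMeasure.mapRange (ENNReal.ofNNRealHom : ℝ≥0 →+ ℝ≥0∞)
    (show Continuous fun x : ℝ≥0 => (x : ℝ≥0∞) from ENNReal.continuous_coe)).ennrealToMeasure

theorem toMeasure_apply (μ : RMeasure ℝ≥0 α) {A : Set α} (hA : MeasurableSet A) :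
    μ.toMeasure A = μ.toVectorMeasure A := by
  rw [toMeasure, VectorMeasure.ennrealToMeasure_apply hA]
  rfl

instance isProbabilityMeasure_toMeasure (μ : RMeasure ℝ≥0 α) :
    IsProbabilityMeasure μ.toMeasure :=
  ⟨by rw [toMeasure_apply _ MeasurableSet.univ, μ.total, ENNReal.coe_one]⟩

theorem ext_of_isPiSystem {μ ν : RMeasure ℝ≥0 α} (C : Set (Set α))
    (hC : (inferInstance : MeasurableSpace α) = MeasurableSpace.generateFrom C)
    (hpi : IsPiSystem C)
    (h : ∀ A ∈ C, (μ.toVectorMeasure A : ℝ≥0∞) = ν.toVectorMeasure A) : μ = ν := by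
  have hm : ∀ A ∈ C, MeasurableSet A := fun A hA =>
    hC.ge _ (MeasurableSpace.measurableSet_generateFrom hA)
  have key : μ.toMeasure = ν.toMeasure := by
    refine ext_of_generate_finite C hC hpi (fun A hA => ?_) (by simp)
    rw [toMeasure_apply _ (hm A hA), toMeasure_apply _ (hm A hA), h A hA]
  refine ext_of_measurableSet fun A hA => ?_
  rw [← ENNReal.coe_inj, ← toMeasure_apply _ hA, ← toMeasure_apply _ hA, key]

end NNReal

end RMeasure

/-! ### Non-contextuality and triviality -/

-- Finiteness of the index is essential: `∏ᶠ` defaults to `1` on infinite support.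
open Classical in
theorem finprod_minimalContextIn_ite {X : Type u} (S : MeasurementScenario X) {U : Set X}
    (hU : U ∈ S.contexts) {R : Type*} [CommSemiring R] (P : S.MinimalContextIn U → Prop) :
    ∏ᶠ V : S.MinimalContextIn U, (if P V then (1 : R) else 0) = if ∀ V, P V then 1 else 0 := by
  have := S.finite_minimalContextIn hU
  have := Fintype.ofFinite (S.MinimalContextIn U)
  rw [finprod_eq_prod_of_fintype, Fintype.prod_ite_zero]
  simp

namespace RMeasureFibration

variable {X : Type u} {S : MeasurementScenario X} {O : X → Type v} [∀ m, MeasurableSpace (O m)]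

/-! ### Sections, marginals and triviality. -/

section Sections

variable {R : Type w} [Semiring R] [TopologicalSpace R]

theorem nonContextualByMarginals_iff_isTrivial (M : RMeasureFibration R S O) :
    M.NonContextualByMarginals ↔ M.IsTrivial := by
  simp only [NonContextualByMarginals, IsTrivial, RMeasure.isIndependentGluing_iff]

theorem nonContextualBySection_iff_nonContextualByMarginals (M : RMeasureFibration R S O) :
    M.NonContextualBySection ↔ M.NonContextualByMarginals := by
  constructor
  · intro H
    have hs : ∀ V (hV : V ∈ S.contexts) (h : V ⊆ ∅),
        (M.state ∅ S.empty_mem).marginal h = M.state V hV := by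
      intro V hV h
      obtain rfl := Set.subset_empty_iff.1 h
      exact RMeasure.marginal_self _
    obtain ⟨t, -⟩ := H ∅ S.empty_mem ⟨M.state ∅ S.empty_mem, hs⟩
    exact ⟨t.measure, fun U hU => (t.mem_total U hU _).symm⟩
  · rintro ⟨ν, hν⟩ U hU s
    refine ⟨⟨ν, fun V hV _ => (hν V hV).symm⟩, ?_⟩
    change ν.marginal _ = _
    rw [← hν U hU, ← s.mem_total U hU subset_rfl, RMeasure.marginal_self]

end Sections

/-! ### Probabilistic hidden variables. -/

section Model

open Classical in
theorem NonContextualByMarginals.nonContextualByModel {M : RMeasureFibration ℝ≥0 S O}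
    (H : M.NonContextualByMarginals) : M.NonContextualByModel := by
  obtain ⟨ν, hν⟩ := H
  refine ⟨Fiber O Set.univ, inferInstance, ν.toMeasure, inferInstance,
    fun V => Kernel.deterministic (Set.domRestrict₂ (π := O) (Set.subset_univ V.1))
      (Set.measurable_restrict₂ _), fun V => inferInstance, fun U hU σ hσ => ?_⟩
  have hE := measurableSet_productEvent S hU hσ
  have hpre := Set.measurable_restrict₂ (Set.subset_univ U) hE
  rw [hν U hU, RMeasure.marginal_apply _ _ hE, ← RMeasure.toMeasure_apply _ hpre,
    ← lintegral_indicator_one hpre]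
  refine lintegral_congr fun l => ?_
  simp only [Kernel.deterministic_apply' _ _ (hσ _), Set.indicator_apply, Pi.one_apply]
  rw [finprod_minimalContextIn_ite S hU]
  rfl

/-- Measurability need only be tested on square cylinders, where the value is a finite product of
kernel evaluations; so infinitely many minimal contexts are allowed. -/
theorem measurable_infinitePi {ι L : Type*} [MeasurableSpace L] {Y : ι → Type*}
    [∀ i, MeasurableSpace (Y i)] (K : ∀ i, Kernel L (Y i)) [∀ i, IsMarkovKernel (K i)] :
    Measurable fun l => Measure.infinitePi fun i => K i l := by
  refine Measurable.measure_of_isPiSystem_of_isProbabilityMeasure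
    (generateFrom_squareCylinders (α := Y)).symm
    (isPiSystem_squareCylinders (fun _ => MeasurableSpace.isPiSystem_measurableSet)
      fun _ => MeasurableSet.univ) ?_
  rintro _ ⟨s, t, ht, rfl⟩
  have ht' : ∀ i, MeasurableSet (t i) := fun i => ht i (Set.mem_univ i)
  simp_rw [Measure.infinitePi_pi _ fun i _ => ht' i]
  exact Finset.measurable_prod _ fun i _ => (K i).measurable_coe (ht' i)

theorem NonContextualByModel.nonContextualByMarginals {M : RMeasureFibration ℝ≥0 S O}
    (H : M.NonContextualByModel) : M.NonContextualByMarginals := by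
  obtain ⟨L, _, p, _, K, _, hK⟩ := H
  have hmeas := measurable_infinitePi K
  let κ : Kernel L (∀ V : S.MinimalContext, Fiber O V.1) := ⟨_, hmeas⟩
  have hκ : ∀ l, κ l = Measure.infinitePi fun V => K V l := fun l => rfl
  have : IsMarkovKernel κ := ⟨fun l => by rw [hκ]; infer_instance⟩
  have hglue := S.measurable_glue O
  have : IsProbabilityMeasure ((p.bind κ).map (S.glue O)) :=
    Measure.isProbabilityMeasure_map hglue.aemeasurable
  refine ⟨RMeasure.ofMeasure ((p.bind κ).map (S.glue O)), fun U hU => ?_⟩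
  refine RMeasure.ext_of_isPiSystem _ (generateFrom_productEvents S hU)
    (isPiSystem_productEvents S U) ?_
  rintro _ ⟨σ, hσ, rfl⟩
  have hE := measurableSet_productEvent S hU hσ
  have hpre := Set.measurable_restrict₂ (Set.subset_univ U) hE
  have hfin : {V : S.MinimalContext | V.1 ⊆ U}.Finite :=
    Set.finite_coe_iff.1 (S.finite_minimalContextIn hU)
  rw [hK U hU σ hσ, RMeasure.marginal_apply _ _ hE, RMeasure.coe_ofMeasure_apply _ hpre,
    Measure.map_apply hglue hpre, Measure.bind_apply (hglue hpre) κ.aemeasurable]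
  refine lintegral_congr fun l => ?_
  rw [S.glue_preimage_productEvent, hκ, ← hfin.coe_toFinset,
    Measure.infinitePi_pi _ fun V _ => hσ V, ← finprod_mem_eq_finite_toFinset_prod _ hfin]
  exact finprod_set_coe_eq_finprod_mem (f := fun V => K V l (σ V))
    {V : S.MinimalContext | V.1 ⊆ U}

end Model

/-! ### Finite hidden variables over a commutative semiring. -/

section FiniteModel

variable {R : Type w} [CommSemiring R] [TopologicalSpace R] [T2Space R] [Finite X]
  [∀ m, Finite (O m)] [∀ m, MeasurableSingletonClass (O m)]

open Classical in
theorem NonContextualByMarginals.nonContextualByFiniteModel {M : RMeasureFibration R S O}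
    (H : M.NonContextualByMarginals) : M.NonContextualByFiniteModel := by
  obtain ⟨ν, hν⟩ := H
  have := Fintype.ofFinite (Fiber O Set.univ)
  refine ⟨Fiber O Set.univ, inferInstance, fun l => ν.toVectorMeasure {l}, ν.sum_singleton,
    fun V l => RMeasure.dirac R (Set.domRestrict₂ (π := O) (Set.subset_univ V.1) l),
    fun U hU σ hσ => ?_⟩
  rw [hν U hU, RMeasure.marginal_apply _ _ (measurableSet_productEvent S hU hσ),
    RMeasure.apply_eq_sum, Finset.sum_filter]
  refine Finset.sum_congr rfl fun l _ => ?_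
  simp only [RMeasure.dirac_apply _ (hσ _)]
  rw [finprod_minimalContextIn_ite S hU, mul_ite, mul_one, mul_zero]
  rfl

-- Minimal contexts outside `U` contribute their total mass `1`. Distributivity then expands the
-- product of sums into a sum over families of local outcomes, reindexed by `glue`.
open Classical in
theorem sum_prod_filter_productEvent [Fintype S.MinimalContext] [Fintype (Fiber O Set.univ)]
    (κ : ∀ V : S.MinimalContext, RMeasure R (Fiber O V.1)) (U : Set X)
    (σ : ∀ V : S.MinimalContext, Set (Fiber O V.1)) :
    ∑ x : Fiber O Set.univ with Set.domRestrict₂ (π := O) (Set.subset_univ U) x ∈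
        productEvent S U σ,
      ∏ V, (κ V).toVectorMeasure {Set.domRestrict₂ (π := O) (Set.subset_univ V.1) x} =
    ∏ᶠ V : S.MinimalContextIn U, (κ V.1).toVectorMeasure (σ V.1) := by
  have := fun V : S.MinimalContext => Fintype.ofFinite (Fiber O V.1)
  have hprod : ∏ᶠ V : S.MinimalContextIn U, (κ V.1).toVectorMeasure (σ V.1) =
      ∏ V, ∑ y with V.1 ⊆ U → y ∈ σ V, (κ V).toVectorMeasure {y} := by
    rw [finprod_eq_prod_of_fintype,
      ← Finset.prod_subtype (Finset.univ.filter fun V : S.MinimalContext => V.1 ⊆ U)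
        (by simp) fun V => (κ V).toVectorMeasure (σ V), Finset.prod_filter]
    refine Finset.prod_congr rfl fun V _ => ?_
    split_ifs with h
    · simp only [h, forall_true_left, RMeasure.apply_eq_sum _ (σ V)]
    · simp only [h, false_imp_iff, Finset.filter_true, RMeasure.sum_singleton]
  rw [hprod, Finset.prod_univ_sum]
  refine Finset.sum_equiv (S.glue O).symm (fun x => ?_) fun x _ => rfl
  simp only [Finset.mem_filter, Finset.mem_univ, true_and, Fintype.mem_piFinset]
  have h := Set.ext_iff.1 (S.glue_preimage_productEvent U σ) ((S.glue O).symm x)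
  simpa only [Set.mem_preimage, Equiv.apply_symm_apply, Set.mem_pi, Set.mem_ofPred_eq] using h

open Classical in
theorem NonContextualByFiniteModel.nonContextualByMarginals {M : RMeasureFibration R S O}
    (H : M.NonContextualByFiniteModel) : M.NonContextualByMarginals := by
  obtain ⟨L, _, p, hp, K, hK⟩ := H
  have := Fintype.ofFinite (Fiber O Set.univ)
  have := Fintype.ofFinite S.MinimalContext
  let w : Fiber O Set.univ → R := fun x => ∑ l, p l *
    ∏ V, (K V l).toVectorMeasure {Set.domRestrict₂ (π := O) (Set.subset_univ V.1) x}
  have hE : ∀ U (σ : ∀ V : S.MinimalContext, Set (Fiber O V.1)),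
      ∑ x with Set.domRestrict₂ (π := O) (Set.subset_univ U) x ∈ productEvent S U σ, w x =
        ∑ l, p l * ∏ᶠ V : S.MinimalContextIn U, (K V.1 l).toVectorMeasure (σ V.1) := by
    intro U σ
    rw [Finset.sum_comm]
    simp only [← Finset.mul_sum, sum_prod_filter_productEvent fun V => K V _]
  -- `X` need not be a context, but `hE` holds for every `U`.
  have hw : ∑ x, w x = 1 := by
    have h := hE Set.univ fun V => Set.univ
    simpa [productEvent, RMeasure.total, hp] using h
  refine ⟨RMeasure.ofWeights w hw, fun U hU => ?_⟩
  have := Fintype.ofFinite (Fiber O U)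
  refine RMeasure.ext_of_singleton fun y => ?_
  rw [RMeasure.marginal_apply _ _ MeasurableSet.of_discrete, RMeasure.ofWeights_apply,
    ← productEvent_singleton S hU y, hK U hU _ fun V => MeasurableSet.of_discrete]
  exact (hE U fun V => {z | ∀ m (h : m ∈ V.1) (h' : m ∈ U), z ⟨m, h⟩ = y ⟨m, h'⟩}).symm

end FiniteModel

end RMeasureFibration

theorem mainTheorem2 {X : Type u} (S : MeasurementScenario X) (O : X → Type v)
    [∀ m, MeasurableSpace (O m)] (G : Type*) [Monoid G] [TopologicalSpace G] [ContinuousMul G] :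
    (∀ (R : Type w) [Semiring R] [TopologicalSpace R] [T2Space R]
      (M : RMeasureGFibration G R S O),
      (M.NonContextualBySection ↔ M.IsTrivial) ∧ (M.NonContextualByMarginals ↔ M.IsTrivial)) ∧
    (∀ M : RMeasureGFibration G ℝ≥0 S O, M.NonContextualByModel ↔ M.IsTrivial) ∧
    (∀ (R : Type w) [CommSemiring R] [TopologicalSpace R] [T2Space R]
      (M : RMeasureGFibration G R S O),
      Finite X → (∀ m, Finite (O m)) → (∀ m, MeasurableSingletonClass (O m)) →
        (M.NonContextualByFiniteModel ↔ M.IsTrivial)) := by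
  refine ⟨fun R _ _ _ M => ⟨?_, M.nonContextualByMarginals_iff_isTrivial⟩, fun M => ?_,
    fun R _ _ _ M _ _ _ => ?_⟩
  · exact M.nonContextualBySection_iff_nonContextualByMarginals.trans
      M.nonContextualByMarginals_iff_isTrivial
  · rw [← M.nonContextualByMarginals_iff_isTrivial]
    exact ⟨fun H => H.nonContextualByMarginals, fun H => H.nonContextualByModel⟩
  · rw [← M.nonContextualByMarginals_iff_isTrivial]
    exact ⟨fun H => H.nonContextualByMarginals, fun H => H.nonContextualByFiniteModel⟩
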